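/- Let $P$ be a probability distribution on a measurable space $\mathcal X$ and let $X_1,X_2,\ldots$ be i.i.d. with law $P$. For $n\ge 1$ let $\hat P_n=\frac1n\sum_{i=1}^n\delta_{X_i}$ be the empirical distribution. Fix $B$, the number of resamples; given the data, let $P_n^{*1},\ldots,P_n^{*B}$ be the empirical distributions of $B$ independent resamples, each consisting of $n$ points drawn independently and uniformly with replacement from $\{X_1,\ldots,X_n\}$. Let $\psi$ be a real-valued functional of probability distributions on $\mathcal X$. For a distribution $Q$, a computation run $\hat\psi_r(Q)$ is a real random variable whose law is a measurable function (Markov kernel) of $Q$. For every $Q$ in a class of distributions that contains $P$ and all empirical distributions of finite nonempty samples (for instance, the class of all distributions), the run is integrable and unbiased, $E\hat\psi_r(Q)=\psi(Q)$. Write $\tau^2(Q)=\mathrm{Var}(\hat\psi_r(Q))\in[0,\infty]$ and $\kappa_3(Q)=E|\hat\psi_r(Q)-\psi(Q)|^3\in[0,\infty]$. For positive integers $R_0=R_0(n)$ and $R=R(n)$ put $$\hat{\hat\psi}_{n,R_0}=\frac1{R_0}\sum_{r=1}^{R_0}\hat\psi_r(\hat P_n),\qquad \psi_{n,R}^{**b}=\frac1R\sum_{r=1}^{R}\hat\psi_r(P_n^{*b}),\quad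 b=1,\ldots,B,$$ where, given the data and the resamples, all these computation runs are independent, each with the law of a run driven by the indicated distribution. Write $\psi=\psi(P)$, $\hat\psi_n=\psi(\hat P_n)$, and $P_n^*$, $\psi_n^*=\psi(P_n^*)$ for a generic resample. Assume: 1. (Bootstrap validity) There is $\sigma>0$ such that $\sqrt n(\hat\psi_n-\psi)\Rightarrow N(0,\sigma^2)$, and, for every $x\in\mathbb R$, $P(\sqrt n(\psi_n^*-\hat\psi_n)\le x\mid X_1,\ldots,X_n)\to P(N(0,\sigma^2)\le x)$ in probability as $n\to\infty$. 2. (Moment consistency of the computation runs) $\tau^2:=\tau^2(P)\in(0,\infty)$ and $\kappa_3(P)<\infty$, and as $n\to\infty$ we have, in probability, $\tau^2(\hat P_n)\to\tau^2(P)$, $\kappa_3(\hat P_n)\to\kappa_3(P)$, $\tau^2(P_n^*)\to\tau^2(P)$ and $\kappa_3(P_n^*)\to\kappa_3(P)$. 3. $R_0/n\to p_0$ and $R/n\to p$ as $n\to\infty$, for constants $0<p_0,p<1$. Then, with $\tau=\sqrt{\tau^2}>0$, as $n\to\infty$, jointly in $\mathbb R^{B+1}$, $$\sqrt n\left(\hat{\hat\psi}_{n,R_0}-\psi,\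 \psi_{n,R}^{**1}-\hat{\hat\psi}_{n,R_0},\ldots,\psi_{n,R}^{**B}-\hat{\hat\psi}_{n,R_0}\right)$$ $$\Rightarrow\left(\sigma Z_0+\frac{\tau}{\sqrt{p_0}}W_0,\ \sigma Z_1+\frac{\tau}{\sqrt p}W_1-\frac{\tau}{\sqrt{p_0}}W_0,\ldots,\ \sigma Z_B+\frac{\tau}{\sqrt p}W_B-\frac{\tau}{\sqrt{p_0}}W_0\right),$$ where $Z_0,\ldots,Z_B,W_0,\ldots,W_B$ are independent standard normal random variables. -/

import Mathlib

open MeasureTheory ProbabilityTheory Filter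
open scoped ENNReal NNReal Topology

namespace CheapBootstrap

noncomputable section

/-- The Markov kernel `a ↦ ⨂ᵢ κ i a`: given `a`, the coordinates are independent and the
`i`-th one has law `κ i a`. -/
def prodKernel {α β ι : Type*} [MeasurableSpace α] [MeasurableSpace β] [Fintype ι]
    (κ : ι → Kernel α β) [∀ i, IsMarkovKernel (κ i)] : Kernel α (ι → β) where
  toFun a := Measure.pi fun i => κ i a
  measurable' := by
    refine Measurable.measure_of_isPiSystem_of_isProbabilityMeasure
      generateFrom_pi.symm isPiSystem_pi ?_
    rintro s ⟨t, ht, rfl⟩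
    simp only [Measure.pi_pi]
    exact Finset.measurable_fun_prod _ fun i _ =>
      Kernel.measurable_coe _ (ht i (Set.mem_univ i))

instance {α β ι : Type*} [MeasurableSpace α] [MeasurableSpace β] [Fintype ι]
    (κ : ι → Kernel α β) [∀ i, IsMarkovKernel (κ i)] : IsMarkovKernel (prodKernel κ) :=
  ⟨fun a => inferInstanceAs (IsProbabilityMeasure (Measure.pi fun i => κ i a))⟩

/-- The empirical distribution `(1/n) ∑ᵢ δ_{xᵢ}` of a sample of size `n ≥ 1`. -/
def empirical {𝓧 : Type*} [MeasurableSpace 𝓧] {n : ℕ+} (x : Fin n → 𝓧) :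
    ProbabilityMeasure 𝓧 :=
  ⟨((n : ℕ) : ℝ≥0∞)⁻¹ • ∑ i, Measure.dirac (x i), ⟨by
    simp [ENNReal.inv_mul_cancel (a := ((n : ℕ) : ℝ≥0∞)) (by simp) (by simp)]⟩⟩

lemma measurable_empirical {𝓧 : Type*} [MeasurableSpace 𝓧] (n : ℕ+) :
    Measurable (empirical : (Fin n → 𝓧) → ProbabilityMeasure 𝓧) := by
  refine Measurable.subtype_mk (Measure.measurable_of_measurable_coe _ fun s hs => ?_)
  simp only [Measure.smul_apply, Measure.finsetSum_apply, smul_eq_mul]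
  refine Measurable.const_mul (Finset.measurable_fun_sum _ fun i _ => ?_) _
  exact (Measure.measurable_coe hs).comp (Measure.measurable_dirac.comp (measurable_pi_apply i))

/-- One draw from the empirical distribution of `x`, as a kernel in the sample `x`. -/
def empiricalKernel (𝓧 : Type*) [MeasurableSpace 𝓧] (n : ℕ+) : Kernel (Fin n → 𝓧) 𝓧 where
  toFun x := (empirical x : Measure 𝓧)
  measurable' := measurable_subtype_coe.comp (measurable_empirical n)

instance (𝓧 : Type*) [MeasurableSpace 𝓧] (n : ℕ+) : IsMarkovKernel (empiricalKernel 𝓧 n) :=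
  ⟨fun x => inferInstanceAs (IsProbabilityMeasure (empirical x : Measure 𝓧))⟩

/-- One bootstrap resample: given the data `x`, draw `n` points independently and uniformly with
replacement from `x`, i.e. `n` i.i.d. draws from the empirical distribution. -/
def resampleKernel (𝓧 : Type*) [MeasurableSpace 𝓧] (n : ℕ+) :
    Kernel (Fin n → 𝓧) (Fin n → 𝓧) :=
  prodKernel fun _ => empiricalKernel 𝓧 n

instance (𝓧 : Type*) [MeasurableSpace 𝓧] (n : ℕ+) : IsMarkovKernel (resampleKernel 𝓧 n) :=
  inferInstanceAs (IsMarkovKernel (prodKernel fun _ => empiricalKernel 𝓧 n))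

/-- Given `x`, draw `B` resamples independently. -/
def resamplesKernel (𝓧 : Type*) [MeasurableSpace 𝓧] (n : ℕ+) (B : ℕ) :
    Kernel (Fin n → 𝓧) (Fin B → Fin n → 𝓧) :=
  prodKernel fun _ => resampleKernel 𝓧 n

/-- `R` independent computation runs, each with law `K Q`, where `Q` is the empirical distribution
of the sample `x`. Here `K Q` is the law of one computation run driven by `Q`. -/
def runsKernel {𝓧 : Type*} [MeasurableSpace 𝓧] (K : Kernel (ProbabilityMeasure 𝓧) ℝ)
    [IsMarkovKernel K] (n R : ℕ+) : Kernel (Fin n → 𝓧) (Fin R → ℝ) :=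
  prodKernel fun _ => K.comap empirical (measurable_empirical n)

instance {𝓧 : Type*} [MeasurableSpace 𝓧] (K : Kernel (ProbabilityMeasure 𝓧) ℝ)
    [IsMarkovKernel K] (n R : ℕ+) : IsMarkovKernel (runsKernel K n R) :=
  inferInstanceAs (IsMarkovKernel
    (prodKernel fun _ => K.comap empirical (measurable_empirical n)))

/-- All computation runs, given the data `x` and the resamples `y 0, …, y (B - 1)`: `R₀` runs driven
by the empirical distribution of `x` and, for each `b`, `R` runs driven by the empirical
distribution of `y b`; all of them are (conditionally) independent. -/
def allRunsKernel {𝓧 : Type*} [MeasurableSpace 𝓧] (K : Kernel (ProbabilityMeasure 𝓧) ℝ)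
    [IsMarkovKernel K] (n : ℕ+) (B : ℕ) (R₀ R : ℕ+) :
    Kernel ((Fin n → 𝓧) × (Fin B → Fin n → 𝓧)) ((Fin R₀ → ℝ) × (Fin B → Fin R → ℝ)) :=
  (runsKernel K n R₀).comap Prod.fst measurable_fst ×ₖ
    prodKernel fun b : Fin B => (runsKernel K n R).comap (fun p => p.2 b) (by fun_prop)

/-- The first `n` data points. -/
def sample {Ω 𝓧 : Type*} (X : ℕ → Ω → 𝓧) (n : ℕ+) (ω : Ω) : Fin n → 𝓧 := fun i => X i ω

/-- The sampling scheme. `X` is an i.i.d. sequence from `P`. For the sample size `n`: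
`Y n · b` is the `b`-th bootstrap resample, the `B` resamples being independent given the data;
`V₀ n` are the `R₀ n` computation runs driven by the empirical distribution of the data, and
`V n · b` are the `R n` computation runs driven by the empirical distribution of the `b`-th
resample, all runs being independent given the data and the resamples. -/
structure NestedSampling {Ω 𝓧 : Type*} [MeasurableSpace Ω] [MeasurableSpace 𝓧]
    (μ : Measure Ω) (P : ProbabilityMeasure 𝓧)
    (K : Kernel (ProbabilityMeasure 𝓧) ℝ) [IsMarkovKernel K] (B : ℕ) (R₀ R : ℕ+ → ℕ+)
    (X : ℕ → Ω → 𝓧) (Y : (n : ℕ+) → Ω → Fin B → Fin n → 𝓧)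
    (V₀ : (n : ℕ+) → Ω → Fin (R₀ n) → ℝ) (V : (n : ℕ+) → Ω → Fin B → Fin (R n) → ℝ) :
    Prop where
  indep_data : iIndepFun X μ
  law_data : ∀ i, HasLaw (X i) (P : Measure 𝓧) μ
  resamples : ∀ n, HasCondDistrib (Y n) (sample X n) (resamplesKernel 𝓧 n B) μ
  runs : ∀ n, HasCondDistrib (fun ω => (V₀ n ω, V n ω)) (fun ω => (sample X n ω, Y n ω))
    (allRunsKernel K n B (R₀ n) (R n)) μ

/-- Computation runs driven by a distribution `Q` in the class `𝓓` are unbiased for `ψ Q`. -/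
def UnbiasedRuns {𝓧 : Type*} [MeasurableSpace 𝓧] (K : Kernel (ProbabilityMeasure 𝓧) ℝ)
    (ψ : ProbabilityMeasure 𝓧 → ℝ) (𝓓 : Set (ProbabilityMeasure 𝓧)) : Prop :=
  ∀ Q ∈ 𝓓, Integrable (fun v : ℝ => v) (K Q) ∧ ∫ v, v ∂(K Q) = ψ Q

/-- `τ²(Q)`, the (possibly infinite) variance of a computation run driven by `Q`. -/
def runVariance {𝓧 : Type*} [MeasurableSpace 𝓧] (K : Kernel (ProbabilityMeasure 𝓧) ℝ)
    (Q : ProbabilityMeasure 𝓧) : ℝ≥0∞ :=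
  evariance (fun v : ℝ => v) (K Q)

/-- `κ₃(Q) = E|ψ̂ᵣ(Q) - ψ(Q)|³`, the (possibly infinite) third absolute central moment of a
computation run driven by `Q`. -/
def runThirdMoment {𝓧 : Type*} [MeasurableSpace 𝓧] (K : Kernel (ProbabilityMeasure 𝓧) ℝ)
    (ψ : ProbabilityMeasure 𝓧 → ℝ) (Q : ProbabilityMeasure 𝓧) : ℝ≥0∞ :=
  ∫⁻ v, ‖v - ψ Q‖ₑ ^ 3 ∂(K Q)

/-- `P(√n (ψ(P*ₙ) - ψ(P̂ₙ)) ≤ t | data = x)`: the conditional distribution function of the centered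
and scaled resample estimate, given the data. -/
def bootstrapCDF {𝓧 : Type*} [MeasurableSpace 𝓧] (ψ : ProbabilityMeasure 𝓧 → ℝ) (n : ℕ+)
    (x : Fin n → 𝓧) (t : ℝ) : ℝ :=
  (resampleKernel 𝓧 n x).real {y | √(n : ℝ) * (ψ (empirical y) - ψ (empirical x)) ≤ t}

/-- Standard condition for bootstrap validity: `√n (ψ(P̂ₙ) - ψ(P)) ⇒ N(0, σ²)`, and
`√n (ψ(P*ₙ) - ψ(P̂ₙ)) ⇒ N(0, σ²)` conditionally on the data, in probability. -/
structure BootstrapValid {Ω 𝓧 : Type*} [MeasurableSpace Ω] [MeasurableSpace 𝓧]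
    (μ : Measure Ω) [IsProbabilityMeasure μ] (P : ProbabilityMeasure 𝓧)
    (ψ : ProbabilityMeasure 𝓧 → ℝ) (X : ℕ → Ω → 𝓧) (σ : ℝ) : Prop where
  pos : 0 < σ
  original : TendstoInDistribution
    (fun (n : ℕ+) ω => √(n : ℝ) * (ψ (empirical (sample X n ω)) - ψ P)) atTop
    (fun z : ℝ => z) (fun _ => μ) (gaussianReal 0 (σ ^ 2).toNNReal)
  resample : ∀ t : ℝ, TendstoInMeasure μ
    (fun (n : ℕ+) ω => bootstrapCDF ψ n (sample X n ω) t) atTop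
    (fun _ => (gaussianReal 0 (σ ^ 2).toNNReal).real (Set.Iic t))

/-- Moment consistency of the computation runs, with `τ² = τ²(P) ∈ (0, ∞)` and `κ₃(P) < ∞`. -/
structure MomentConsistent {Ω 𝓧 : Type*} [MeasurableSpace Ω] [MeasurableSpace 𝓧]
    (μ : Measure Ω) (P : ProbabilityMeasure 𝓧) (K : Kernel (ProbabilityMeasure 𝓧) ℝ)
    (ψ : ProbabilityMeasure 𝓧 → ℝ) {B : ℕ} (X : ℕ → Ω → 𝓧)
    (Y : (n : ℕ+) → Ω → Fin B → Fin n → 𝓧) (τ : ℝ) : Prop where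
  pos : 0 < τ
  variance_eq : runVariance K P = ENNReal.ofReal (τ ^ 2)
  thirdMoment_lt_top : runThirdMoment K ψ P < ∞
  variance_data : TendstoInMeasure μ
    (fun (n : ℕ+) ω => runVariance K (empirical (sample X n ω))) atTop
    (fun _ => runVariance K P)
  thirdMoment_data : TendstoInMeasure μ
    (fun (n : ℕ+) ω => runThirdMoment K ψ (empirical (sample X n ω))) atTop
    (fun _ => runThirdMoment K ψ P)
  variance_resample : ∀ b, TendstoInMeasure μ
    (fun (n : ℕ+) ω => runVariance K (empirical (Y n ω b))) atTop
    (fun _ => runVariance K P)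
  thirdMoment_resample : ∀ b, TendstoInMeasure μ
    (fun (n : ℕ+) ω => runThirdMoment K ψ (empirical (Y n ω b))) atTop
    (fun _ => runThirdMoment K ψ P)

/-- The average of finitely many computation runs. -/
def average {R : ℕ+} (v : Fin R → ℝ) : ℝ := (∑ r, v r) / (R : ℝ)

end

end CheapBootstrap

open CheapBootstrap

/-!
The scaled error of each computed estimate splits into a sampling error, which depends on the data
and the resamples only, and a computation error, the scaled average of centered runs.

Given the data and the resamples the computation errors are independent, and a Taylor expansion of
their characteristic functions, with the third absolute moment controlling the remainder, gives
conditional central limit theorems whose Gaussian limits are not random. Likewise, given the data,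
the errors of the `B` resamples are independent with a nonrandom Gaussian limit.

If `Uₙ` converges in distribution and the conditional characteristic function of `Vₙ`, given
variables that determine `Uₙ`, converges in probability to a nonrandom one, then `(Uₙ, Vₙ)`
converges to the product of the limits. Applied once to the resamples and once to the runs, this
yields the joint limit of all the errors, and the theorem is its image under a linear map.
-/

namespace CheapBootstrap

lemma norm_cexp_mul_I_sub_taylor_two_le (x : ℝ) :
    ‖Complex.exp (x * Complex.I) - (1 + x * Complex.I - (x : ℂ) ^ 2 / 2)‖ ≤ |x| ^ 3 := by
  obtain hx | hx := le_total |x| 2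
  · have htaylor : ∑ m ∈ Finset.range 3, (x * Complex.I) ^ m / (m.factorial : ℂ)
        = 1 + x * Complex.I - (x : ℂ) ^ 2 / 2 := by
      simp only [Finset.sum_range_succ, Finset.range_one, Finset.sum_singleton, mul_pow, pow_zero,
        mul_one, Nat.factorial, Nat.cast_one, div_one, pow_one, zero_add, Complex.I_sq, mul_neg,
        Nat.reduceAdd, Nat.succ_eq_add_one, Nat.cast_ofNat]
      ring
    have h := Complex.exp_bound' (x := x * Complex.I) (n := 3) (by
      rw [norm_mul, Complex.norm_I, Complex.norm_real, Real.norm_eq_abs]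
      norm_num
      linarith)
    rw [htaylor, norm_mul, Complex.norm_I, Complex.norm_real, Real.norm_eq_abs, mul_one] at h
    refine h.trans ?_
    norm_num [Nat.factorial]
    linarith [pow_nonneg (abs_nonneg x) 3]
  · calc ‖Complex.exp (x * Complex.I) - (1 + x * Complex.I - (x : ℂ) ^ 2 / 2)‖
        ≤ ‖Complex.exp (x * Complex.I)‖ + (‖(1 : ℂ)‖ + ‖x * Complex.I‖ + ‖(x : ℂ) ^ 2 / 2‖) :=
          norm_sub_le_of_le le_rfl (norm_sub_le_of_le (norm_add_le _ _) le_rfl)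
      _ = 2 + |x| + |x| ^ 2 / 2 := by
          rw [Complex.norm_exp_ofReal_mul_I]
          simp only [norm_one, norm_mul, norm_div, norm_pow, Complex.norm_real, Complex.norm_I,
            Real.norm_eq_abs, Complex.norm_ofNat]
          ring
      _ ≤ |x| ^ 3 := by nlinarith [mul_nonneg (abs_nonneg x) (sub_nonneg.2 hx)]

lemma norm_charFun_sub_taylor_two_le {ν : Measure ℝ} [IsProbabilityMeasure ν]
    (hν : MemLp (fun x : ℝ => x) 3 ν) (hmean : ∫ x, x ∂ν = 0) (u : ℝ) :
    ‖charFun ν u - (1 - u ^ 2 * (∫ x, x ^ 2 ∂ν) / 2 : ℝ)‖ ≤ |u| ^ 3 * ∫ x, |x| ^ 3 ∂ν := by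
  have hint1 : Integrable (fun x : ℝ => x) ν := hν.integrable (by norm_num)
  have hint2 : Integrable (fun x : ℝ => x ^ 2) ν :=
    (hν.mono_exponent (by norm_num)).integrable_sq
  have hint3 : Integrable (fun x : ℝ => |x| ^ 3) ν := hν.integrable_norm_pow (by norm_num)
  have hcexp : Integrable (fun x : ℝ => Complex.exp ((u * x : ℝ) * Complex.I)) ν :=
    .of_bound (by fun_prop) 1 (ae_of_all _ fun x => (Complex.norm_exp_ofReal_mul_I _).le)
  have hlin : Integrable (fun x : ℝ => 1 + ((u * x : ℝ) : ℂ) * Complex.I) ν :=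
    (integrable_const 1).add ((hint1.const_mul u).ofReal.mul_const _)
  have hquad : Integrable (fun x : ℝ => ((u ^ 2 * x ^ 2 / 2 : ℝ) : ℂ)) ν :=
    ((hint2.const_mul _).div_const 2).ofReal
  have htaylor : Integrable (fun x : ℝ => 1 + ((u * x : ℝ) : ℂ) * Complex.I
      - ((u ^ 2 * x ^ 2 / 2 : ℝ) : ℂ)) ν := hlin.sub hquad
  have hremainder : charFun ν u - (1 - u ^ 2 * (∫ x, x ^ 2 ∂ν) / 2 : ℝ)
      = ∫ x, (Complex.exp ((u * x : ℝ) * Complex.I)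
        - (1 + ((u * x : ℝ) : ℂ) * Complex.I - ((u ^ 2 * x ^ 2 / 2 : ℝ) : ℂ))) ∂ν := by
    rw [integral_sub hcexp htaylor, integral_sub hlin hquad,
      integral_add (integrable_const 1) ((hint1.const_mul u).ofReal.mul_const _),
      integral_mul_const, integral_complex_ofReal, integral_complex_ofReal, integral_const_mul,
      integral_div, integral_const_mul, hmean, charFun_apply_real]
    simp
  rw [hremainder, ← integral_const_mul]
  refine norm_integral_le_of_norm_le (hint3.const_mul _) (ae_of_all _ fun x => ?_)
  have h := norm_cexp_mul_I_sub_taylor_two_le (u * x)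
  rw [abs_mul, mul_pow] at h
  simpa [mul_pow] using h

lemma tendsto_pow_cexp_of_tendsto_mul_sub_one {α : Type*} {l : Filter α} {z : α → ℂ} {R : α → ℕ}
    {c : ℂ} (hR : Tendsto R l atTop)
    (h : Tendsto (fun a => (R a : ℂ) * (z a - 1)) l (𝓝 c)) :
    Tendsto (fun a => z a ^ R a) l (𝓝 (Complex.exp c)) := by
  have hR0 : ∀ᶠ a in l, (R a : ℂ) ≠ 0 :=
    (hR.eventually_ne_atTop 0).mono fun a ha => Nat.cast_ne_zero.2 ha
  have hz : Tendsto (fun a => z a - 1) l (𝓝 0) := by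
    have hinv : Tendsto (fun a => (R a : ℂ)⁻¹) l (𝓝 0) :=
      tendsto_inv_atTop_nhds_zero_nat.comp hR
    refine ((hinv.mul h).congr' ?_).trans_eq (by simp)
    filter_upwards [hR0] with a ha using inv_mul_cancel_left₀ ha _
  have hlog : Tendsto (fun a => (R a : ℂ) * (Complex.log (z a) - (z a - 1))) l (𝓝 0) := by
    have hO := (Asymptotics.isBigO_refl (fun a => (R a : ℂ)) l).mul
      (Complex.log_sub_self_isBigO.comp_tendsto hz)
    refine (hO.trans_tendsto ?_).congr fun a => by simp
    simpa [pow_two, mul_assoc] using h.mul hz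
  have hexp := (Complex.continuous_exp.tendsto c).comp (by simpa using hlog.add h)
  refine hexp.congr' ?_
  have hz1 : ∀ᶠ a in l, z a ≠ 0 :=
    (tendsto_sub_nhds_zero_iff.1 hz).eventually_ne one_ne_zero
  filter_upwards [hz1] with a ha
  rw [Function.comp_apply, ← mul_add, sub_add_cancel, Complex.exp_nat_mul, Complex.exp_log ha]

lemma tendsto_charFun_pow_of_lyapunov {α : Type*} {l : Filter α} {ν : α → Measure ℝ}
    [∀ a, IsProbabilityMeasure (ν a)] {R : α → ℕ} {u : α → ℝ} {v : ℝ}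
    (hν : ∀ᶠ a in l, MemLp (fun x : ℝ => x) 3 (ν a)) (hmean : ∀ a, ∫ x, x ∂(ν a) = 0)
    (hR : Tendsto R l atTop)
    (hvar : Tendsto (fun a => R a * (u a ^ 2 * ∫ x, x ^ 2 ∂(ν a))) l (𝓝 v))
    (hlyap : Tendsto (fun a => R a * (|u a| ^ 3 * ∫ x, |x| ^ 3 ∂(ν a))) l (𝓝 0)) :
    Tendsto (fun a => charFun (ν a) (u a) ^ R a) l (𝓝 (Complex.exp ((-(v / 2) : ℝ) : ℂ))) := by
  refine tendsto_pow_cexp_of_tendsto_mul_sub_one hR ?_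
  have hmain : Tendsto (fun a => ((-(R a * (u a ^ 2 * ∫ x, x ^ 2 ∂(ν a)) / 2) : ℝ) : ℂ)) l
      (𝓝 ((-(v / 2) : ℝ) : ℂ)) :=
    (Complex.continuous_ofReal.tendsto _).comp (hvar.div_const 2).neg
  refine tendsto_of_tendsto_of_dist hmain (squeeze_zero' (.of_forall fun _ => dist_nonneg) ?_ hlyap)
  filter_upwards [hν] with a ha
  have hdiff : ((-(R a * (u a ^ 2 * ∫ x, x ^ 2 ∂(ν a)) / 2) : ℝ) : ℂ)
      - R a * (charFun (ν a) (u a) - 1)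
      = -(R a * (charFun (ν a) (u a) - (1 - u a ^ 2 * (∫ x, x ^ 2 ∂(ν a)) / 2 : ℝ))) := by
    push_cast
    ring
  rw [dist_eq_norm, hdiff, norm_neg, norm_mul, Complex.norm_natCast]
  gcongr
  exact norm_charFun_sub_taylor_two_le ha (hmean a) (u a)

section InProbability

variable {Ω ι E 𝕜 : Type*} [MeasurableSpace Ω] {μ : Measure Ω} {l : Filter ι}

/-- The filter of convergence in probability: a family `A i ω` tends to `a` along
`inProbability μ l` iff `A i → a` in `μ`-probability as `i` runs along `l`. It makes all the
algebra of limits available for convergence in probability. -/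
def inProbability (μ : Measure Ω) (l : Filter ι) : Filter (ι × Ω) where
  sets := {S | Tendsto (fun i => μ {ω | (i, ω) ∉ S}) l (𝓝 0)}
  univ_sets := by simpa using tendsto_const_nhds
  sets_of_superset hS hST :=
    tendsto_of_tendsto_of_tendsto_of_le_of_le tendsto_const_nhds hS (fun _ => zero_le)
      fun _ => measure_mono fun _ hω h => hω (hST h)
  inter_sets {S T} hS hT := by
    have h : Tendsto (fun i => μ {ω | (i, ω) ∉ S} + μ {ω | (i, ω) ∉ T}) l (𝓝 0) := by
      simpa using Tendsto.add hS hT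
    refine tendsto_of_tendsto_of_tendsto_of_le_of_le tendsto_const_nhds h (fun _ => zero_le)
      fun i => (measure_mono fun ω hω => ?_).trans (measure_union_le _ _)
    exact Set.mem_union _ _ _ |>.2 (not_and_or.1 hω)

lemma tendsto_fst_inProbability : Tendsto Prod.fst (inProbability μ l) l := fun S hS => by
  refine tendsto_const_nhds.congr' ?_
  filter_upwards [hS] with i hi
  simp [hi]

lemma tendsto_inProbability_of_tendstoInMeasure [TopologicalSpace E] [WeakPseudoEMetricSpace E]
    {A : ι → Ω → E} {a : E} (h : TendstoInMeasure μ A l fun _ => a) :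
    Tendsto (fun q : ι × Ω => A q.1 q.2) (inProbability μ l) (𝓝 a) := by
  intro U hU
  obtain ⟨V, hVU, hV, haV⟩ := mem_nhds_iff.1 hU
  obtain ⟨ε, hε, hball⟩ : ∃ ε > 0, ∀ x, edist x a < ε → x ∈ V :=
    (@EMetric.isOpen_iff E (.ofEDist edist WeakPseudoEMetricSpace.edist_self
      WeakPseudoEMetricSpace.edist_comm WeakPseudoEMetricSpace.edist_triangle) V).1
      (WeakPseudoEMetricSpace.topology_le V hV) a haV
  exact tendsto_of_tendsto_of_tendsto_of_le_of_le tendsto_const_nhds (h ε hε)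
    (fun _ => zero_le) fun i => measure_mono fun ω hω =>
      not_lt.1 fun hlt => hω (hVU (hball _ hlt))

lemma tendstoInMeasure_of_tendsto_inProbability [PseudoEMetricSpace E] {A : ι → Ω → E} {a : E}
    (h : Tendsto (fun q : ι × Ω => A q.1 q.2) (inProbability μ l) (𝓝 a)) :
    TendstoInMeasure μ A l fun _ => a := fun ε hε => by
  simpa [inProbability] using h (Metric.eball_mem_nhds a hε)

lemma tendsto_integral_norm_sub_of_inProbability [NormedAddCommGroup E] [IsFiniteMeasure μ]
    [l.IsCountablyGenerated] {Φ : ι → Ω → E} {c : E} {C : ℝ}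
    (hΦm : ∀ i, AEStronglyMeasurable (Φ i) μ) (hΦ : ∀ i ω, ‖Φ i ω‖ ≤ C)
    (h : Tendsto (fun q : ι × Ω => Φ q.1 q.2) (inProbability μ l) (𝓝 c)) :
    Tendsto (fun i => ∫ ω, ‖Φ i ω - c‖ ∂μ) l (𝓝 0) := by
  refine tendsto_of_subseq_tendsto fun ns hns => ?_
  obtain ⟨ms, -, hms⟩ := TendstoInMeasure.exists_seq_tendsto_ae fun ε hε =>
    (tendstoInMeasure_of_tendsto_inProbability h ε hε).comp hns
  refine ⟨ms, ?_⟩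
  rw [← integral_zero Ω ℝ (μ := μ)]
  refine tendsto_integral_of_dominated_convergence (fun _ => C + ‖c‖)
    (fun k => ((hΦm _).sub aestronglyMeasurable_const).norm) (integrable_const _)
    (fun k => ae_of_all _ fun ω => ?_) ?_
  · rw [norm_norm]
    exact norm_sub_le_of_le (hΦ _ ω) le_rfl
  · filter_upwards [hms] with ω hω
    exact tendsto_iff_norm_sub_tendsto_zero.1 hω

lemma tendsto_integral_mul_of_inProbability [RCLike 𝕜] [IsFiniteMeasure μ]
    [l.IsCountablyGenerated] {G Φ : ι → Ω → 𝕜} {g c : 𝕜} {C : ℝ}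
    (hGm : ∀ i, AEStronglyMeasurable (G i) μ) (hΦm : ∀ i, AEStronglyMeasurable (Φ i) μ)
    (hG : ∀ i ω, ‖G i ω‖ ≤ 1) (hΦ : ∀ i ω, ‖Φ i ω‖ ≤ C)
    (hlim : Tendsto (fun i => ∫ ω, G i ω ∂μ) l (𝓝 g))
    (h : Tendsto (fun q : ι × Ω => Φ q.1 q.2) (inProbability μ l) (𝓝 c)) :
    Tendsto (fun i => ∫ ω, G i ω * Φ i ω ∂μ) l (𝓝 (g * c)) := by
  have hGint (i : ι) : Integrable (G i) μ := .of_bound (hGm i) 1 (ae_of_all _ (hG i))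
  have hΦint (i : ι) : Integrable (Φ i) μ := .of_bound (hΦm i) C (ae_of_all _ (hΦ i))
  refine tendsto_of_tendsto_of_dist (hlim.mul_const c) ?_
  refine squeeze_zero (fun _ => dist_nonneg) (fun i => ?_)
    (tendsto_integral_norm_sub_of_inProbability hΦm hΦ h)
  rw [dist_comm, dist_eq_norm, ← integral_mul_const,
    ← integral_sub ((hΦint i).bdd_mul (hGm i) (ae_of_all _ (hG i))) ((hGint i).mul_const c)]
  refine norm_integral_le_of_norm_le ((hΦint i).sub (integrable_const c)).norm
    (ae_of_all _ fun ω => ?_)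
  rw [← mul_sub, norm_mul]
  exact mul_le_of_le_one_left (norm_nonneg _) (hG i ω)

end InProbability

lemma tendsto_probabilityMeasure_of_tendsto_cdf {α : Type*} {l : Filter α}
    {ν : α → ProbabilityMeasure ℝ} {γ : ProbabilityMeasure ℝ}
    (h : ∀ x : ℝ, Tendsto (fun a => (ν a : Measure ℝ).real (Set.Iic x)) l
      (𝓝 ((γ : Measure ℝ).real (Set.Iic x)))) : Tendsto ν l (𝓝 γ) := by
  -- The coarsest filter along which the distribution functions converge at the rationals is
  -- countably generated, which the criterion for π-systems requires and `l` need not be.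
  let F : Filter (ProbabilityMeasure ℝ) := ⨅ q : ℚ,
    comap (fun ρ => (ρ : Measure ℝ).real (Set.Iic (q : ℝ)))
      (𝓝 ((γ : Measure ℝ).real (Set.Iic (q : ℝ))))
  have hF (q : ℚ) : Tendsto (fun ρ : ProbabilityMeasure ℝ => (ρ : Measure ℝ).real (Set.Iic (q : ℝ)))
      F (𝓝 ((γ : Measure ℝ).real (Set.Iic (q : ℝ)))) := tendsto_comap.mono_left (iInf_le _ q)
  have hIoc (ρ : ProbabilityMeasure ℝ) {a b : ℚ} (hab : a ≤ b) :
      ((ρ (Set.Ioc (a : ℝ) b) : ℝ≥0) : ℝ)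
        = (ρ : Measure ℝ).real (Set.Iic (b : ℝ)) - (ρ : Measure ℝ).real (Set.Iic (a : ℝ)) := by
    rw [← measureReal_sdiff (Set.Iic_subset_Iic.2 (Rat.cast_le.2 hab)) measurableSet_Iic,
      Set.Iic_sdiff_Iic]
    rfl
  suffices hFγ : Tendsto id F (𝓝 γ) from
    hFγ.comp (tendsto_iInf.2 fun q => tendsto_comap_iff.2 (h q))
  refine IsPiSystem.tendsto_probabilityMeasure_of_tendsto_of_mem
    (S := {s | ∃ a b : ℚ, a ≤ b ∧ s = Set.Ioc (a : ℝ) b}) ?_ ?_ ?_ ?_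
  · rintro _ ⟨a, b, -, rfl⟩ _ ⟨c, d, -, rfl⟩ hne
    rw [Set.Ioc_inter_Ioc] at hne ⊢
    exact ⟨max a c, min b d, by exact_mod_cast (Set.nonempty_Ioc.1 hne).le, by push_cast; rfl⟩
  · rintro _ ⟨a, b, -, rfl⟩
    exact measurableSet_Ioc
  · intro U hU x hx
    obtain ⟨a', b', ⟨ha', hb'⟩, hU'⟩ := mem_nhds_iff_exists_Ioo_subset.1 (hU.mem_nhds hx)
    obtain ⟨a, haa', hax⟩ := exists_rat_btwn ha'
    obtain ⟨b, hxb, hbb'⟩ := exists_rat_btwn hb'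
    refine ⟨_, ⟨a, b, by exact_mod_cast (hax.trans hxb).le, rfl⟩, Ioc_mem_nhds hax hxb, ?_⟩
    exact fun y hy => hU' ⟨haa'.trans hy.1, hy.2.trans_lt hbb'⟩
  · rintro _ ⟨a, b, hab, rfl⟩
    rw [← NNReal.tendsto_coe]
    simp_rw [id, hIoc _ hab]
    exact (hF b).sub (hF a)

section Levy

variable {α E : Type*} {l : Filter α} [NormedAddCommGroup E] [NormedSpace ℝ E]
  [MeasurableSpace E] [BorelSpace E] {ν : α → ProbabilityMeasure E} {γ : ProbabilityMeasure E}

lemma tendsto_charFunDual_of_tendsto (h : Tendsto ν l (𝓝 γ)) (L : StrongDual ℝ E) :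
    Tendsto (fun a => charFunDual (ν a : Measure E) L) l (𝓝 (charFunDual (γ : Measure E) L)) :=
  (ProbabilityMeasure.tendsto_iff_forall_integral_rclike_tendsto ℂ).1 h
    (BoundedContinuousFunction.probCharDual L)

lemma tendsto_of_tendsto_charFunDual [FiniteDimensional ℝ E] [l.IsCountablyGenerated]
    (h : ∀ L : StrongDual ℝ E,
      Tendsto (fun a => charFunDual (ν a : Measure E) L) l (𝓝 (charFunDual (γ : Measure E) L))) :
    Tendsto ν l (𝓝 γ) := by
  refine tendsto_of_seq_tendsto fun k hk => ?_
  let T : E ≃L[ℝ] EuclideanSpace ℝ (Fin (Module.finrank ℝ E)) := toEuclidean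
  have hchar (ρ : ProbabilityMeasure E) (t : EuclideanSpace ℝ (Fin (Module.finrank ℝ E))) :
      charFun (ρ.map T.continuous.measurable.aemeasurable : Measure _) t
        = charFunDual (ρ : Measure E)
          (InnerProductSpace.toDualMap ℝ _ t ∘L T.toContinuousLinearMap) := by
    rw [charFun_eq_charFunDual_toDualMap, ← charFunDual_map]
    rfl
  have hT : Tendsto (fun n => (ν (k n)).map T.continuous.measurable.aemeasurable) atTop
      (𝓝 (γ.map T.continuous.measurable.aemeasurable)) := by
    refine ProbabilityMeasure.tendsto_of_tendsto_charFun fun t => ?_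
    simp_rw [hchar]
    exact (h _).comp hk
  have hTsymm (ρ : ProbabilityMeasure E) : (ρ.map T.continuous.measurable.aemeasurable).map
      T.symm.continuous.measurable.aemeasurable = ρ :=
    Subtype.ext <| (Measure.map_map T.symm.continuous.measurable T.continuous.measurable).trans
      (by rw [T.symm_comp_self, Measure.map_id]; rfl)
  simpa only [hTsymm, Function.comp_def] using
    ProbabilityMeasure.tendsto_map_of_tendsto_of_continuous _ _ hT T.symm.continuous

end Levy

section TwoStage

variable {Ω E F : Type*} [MeasurableSpace Ω] {μ : Measure Ω} [IsProbabilityMeasure μ]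
  [NormedAddCommGroup E] [NormedSpace ℝ E] [MeasurableSpace E] [BorelSpace E]
  [NormedAddCommGroup F] [NormedSpace ℝ F] [MeasurableSpace F] [BorelSpace F]

lemma charFunDual_map_eq_integral {α : Type*} [MeasurableSpace α] {ν : Measure α} {f : α → E}
    (hf : AEMeasurable f ν) (L : StrongDual ℝ E) :
    charFunDual (ν.map f) L = ∫ a, Complex.exp (L (f a) * Complex.I) ∂ν := by
  rw [charFunDual_apply, integral_map hf (by fun_prop)]

section

variable {α β : Type*} [MeasurableSpace α] [MeasurableSpace β] {X : Ω → α} {Y : Ω → β}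
  {κ : Kernel α β} [IsMarkovKernel κ] {f : α → E} {g : α × β → F}

lemma measurable_charFunDual_map_kernel (hg : Measurable g) (L : StrongDual ℝ F) :
    Measurable fun a => charFunDual ((κ a).map fun b => g (a, b)) L := by
  have heq (a : α) : charFunDual ((κ a).map fun b => g (a, b)) L
      = ∫ b, Complex.exp (L (g (a, b)) * Complex.I) ∂κ a :=
    charFunDual_map_eq_integral (by fun_prop) L
  simp_rw [heq]
  have hmeas : Measurable fun z : α × β => Complex.exp (L (g z) * Complex.I) := by fun_prop
  exact hmeas.stronglyMeasurable.integral_kernel_prod_right'.measurable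

lemma charFunDual_map_prodMk_of_hasCondDistrib [SecondCountableTopologyEither E F]
    (h : HasCondDistrib Y X κ μ) (hf : Measurable f) (hg : Measurable g)
    (L : StrongDual ℝ (E × F)) :
    charFunDual (μ.map fun ω => (f (X ω), g (X ω, Y ω))) L
      = ∫ ω, Complex.exp ((L ∘L .inl ℝ E F) (f (X ω)) * Complex.I)
          * charFunDual ((κ (X ω)).map fun b => g (X ω, b)) (L ∘L .inr ℝ E F) ∂μ := by
  have hX : AEMeasurable X μ := h.aemeasurable_fst
  have hY : AEMeasurable Y μ := h.aemeasurable_snd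
  have := Measure.isProbabilityMeasure_map hX
  have hmeas : Measurable fun z : α × β =>
      Complex.exp (L (f z.1, g z) * Complex.I) := by fun_prop
  have hint : Integrable (fun z : α × β => Complex.exp (L (f z.1, g z) * Complex.I))
      (μ.map X ⊗ₘ κ) := .of_bound hmeas.aestronglyMeasurable 1
    (ae_of_all _ fun _ => (Complex.norm_exp_ofReal_mul_I _).le)
  calc charFunDual (μ.map fun ω => (f (X ω), g (X ω, Y ω))) L
      = ∫ ω, Complex.exp (L (f (X ω), g (X ω, Y ω)) * Complex.I) ∂μ :=
        charFunDual_map_eq_integral (by fun_prop) L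
    _ = ∫ z, Complex.exp (L (f z.1, g z) * Complex.I) ∂(μ.map X ⊗ₘ κ) :=
        HasLaw.integral_comp h hmeas.aestronglyMeasurable
    _ = ∫ ω, ∫ b, Complex.exp (L (f (X ω), g (X ω, b)) * Complex.I) ∂κ (X ω) ∂μ := by
        rw [Measure.integral_compProd hint, integral_map hX
          hmeas.stronglyMeasurable.integral_kernel_prod_right'.aestronglyMeasurable]
    _ = _ := by
        congr with ω
        rw [charFunDual_map_eq_integral (by fun_prop), ← integral_const_mul]
        congr with b
        rw [← Complex.exp_add, ← add_mul, ← Complex.ofReal_add,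
          L.comp_inl_add_comp_inr (f (X ω), g (X ω, b))]

end

theorem tendstoInDistribution_prodMk_of_hasCondDistrib {ι : Type*} {l : Filter ι}
    [l.IsCountablyGenerated] [FiniteDimensional ℝ E] [FiniteDimensional ℝ F]
    [SecondCountableTopologyEither E F] {α β : ι → Type*} [∀ i, MeasurableSpace (α i)]
    [∀ i, MeasurableSpace (β i)] {X : ∀ i, Ω → α i} {Y : ∀ i, Ω → β i}
    {κ : ∀ i, Kernel (α i) (β i)} [∀ i, IsMarkovKernel (κ i)]
    {f : ∀ i, α i → E} {g : ∀ i, α i × β i → F} {ρ : Measure E} [IsProbabilityMeasure ρ]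
    {γ : Measure F} [IsProbabilityMeasure γ]
    (hXY : ∀ i, HasCondDistrib (Y i) (X i) (κ i) μ)
    (hf : ∀ i, Measurable (f i)) (hg : ∀ i, Measurable (g i))
    (hlim : TendstoInDistribution (fun i ω => f i (X i ω)) l id (fun _ => μ) ρ)
    (hcond : ∀ L : StrongDual ℝ F, Tendsto
      (fun q : ι × Ω => charFunDual ((κ q.1 (X q.1 q.2)).map fun b => g q.1 (X q.1 q.2, b)) L)
      (inProbability μ l) (𝓝 (charFunDual γ L))) :
    TendstoInDistribution (fun i ω => (f i (X i ω), g i (X i ω, Y i ω))) l id (fun _ => μ)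
      (ρ.prod γ) where
  forall_aemeasurable i := by
    have hX : AEMeasurable (X i) μ := (hXY i).aemeasurable_fst
    have hY : AEMeasurable (Y i) μ := (hXY i).aemeasurable_snd
    have := hf i
    have := hg i
    fun_prop
  tendsto := by
    have hX (i : ι) : AEMeasurable (X i) μ := (hXY i).aemeasurable_fst
    refine tendsto_of_tendsto_charFunDual fun L => ?_
    have hmeas (i : ι) : AEMeasurable (fun ω => f i (X i ω)) μ := (hf i).comp_aemeasurable (hX i)
    have hfirst := tendsto_charFunDual_of_tendsto hlim.tendsto (L ∘L .inl ℝ E F)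
    simp only [ProbabilityMeasure.coe_mk, Measure.map_id, charFunDual_prod,
      charFunDual_map_prodMk_of_hasCondDistrib (hXY _) (hf _) (hg _),
      charFunDual_map_eq_integral (hmeas _)] at hfirst ⊢
    refine tendsto_integral_mul_of_inProbability (C := 1) (fun i => ?_) (fun i => ?_)
      (fun i ω => (Complex.norm_exp_ofReal_mul_I _).le) (fun i ω => ?_) hfirst (hcond _)
    · have hexp : Measurable fun x => Complex.exp ((L ∘L .inl ℝ E F) x * Complex.I) := by fun_prop
      exact (hexp.comp_aemeasurable (hmeas i)).aestronglyMeasurable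
    · exact ((measurable_charFunDual_map_kernel (hg i) _).comp_aemeasurable
        (hX i)).aestronglyMeasurable
    · have hgω : Measurable fun b => g i (X i ω, b) := (hg i).comp measurable_prodMk_left
      rw [charFunDual_map_eq_integral hgω.aemeasurable]
      exact (norm_integral_le_of_norm_le_const (ae_of_all _ fun b =>
        (Complex.norm_exp_ofReal_mul_I _).le)).trans_eq (by simp)

end TwoStage

section CenteredLaw

variable {ν : Measure ℝ} {m : ℝ}

lemma integral_map_sub_integral_eq_zero [IsProbabilityMeasure ν]
    (hint : Integrable (fun v : ℝ => v) ν) (hm : ∫ v, v ∂ν = m) :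
    ∫ x, x ∂(ν.map (· - m)) = 0 := by
  rw [integral_map (by fun_prop) (by fun_prop), integral_sub hint (integrable_const m), hm]
  simp

lemma integral_sq_map_sub_integral (hm : ∫ v, v ∂ν = m) :
    ∫ x, x ^ 2 ∂(ν.map (· - m)) = (evariance (fun v : ℝ => v) ν).toReal := by
  rw [integral_map (by fun_prop) (by fun_prop), ← hm]
  exact (variance_eq_integral (X := fun v : ℝ => v) (by fun_prop)).symm

lemma integral_abs_pow_map_sub_const (m : ℝ) (k : ℕ) :
    ∫ x, |x| ^ k ∂(ν.map (· - m)) = (∫⁻ v, ‖v - m‖ₑ ^ k ∂ν).toReal := by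
  rw [integral_map (by fun_prop) (by fun_prop), ← integral_toReal (by fun_prop) (by simp)]
  simp

lemma memLp_map_sub_const {k : ℕ} (hk : k ≠ 0) (h : ∫⁻ v, ‖v - m‖ₑ ^ k ∂ν ≠ ∞) :
    MemLp (fun x : ℝ => x) k (ν.map (· - m)) := by
  refine ⟨by fun_prop, ?_⟩
  rw [eLpNorm_lt_top_iff_lintegral_rpow_enorm_lt_top (by exact_mod_cast hk) (by simp),
    lintegral_map (by fun_prop) (by fun_prop)]
  simpa using h.lt_top

end CenteredLaw

lemma charFun_map_const_mul_sum_pi {ι α : Type*} [Fintype ι] [MeasurableSpace α] {ν : Measure α}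
    [IsProbabilityMeasure ν] {f : α → ℝ} (hf : Measurable f) (c t : ℝ) :
    charFun ((Measure.pi fun _ : ι => ν).map fun v => c * ∑ i, f (v i)) t
      = charFun (ν.map f) (c * t) ^ Fintype.card ι := by
  have := Measure.isProbabilityMeasure_map (μ := ν) hf.aemeasurable
  have hsum : (Measure.pi fun _ : ι => ν).map (fun v => c * ∑ i, f (v i))
      = (((Measure.pi fun _ : ι => ν.map f).map fun w => ∑ i, w i).map (c * ·)) := by
    rw [← Measure.pi_map_pi fun _ => hf.aemeasurable, Measure.map_map (by fun_prop) (by fun_prop),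
      Measure.map_map (by fun_prop) (by fun_prop)]
    rfl
  rw [hsum, charFun_map_mul, charFun_map_sum_pi_eq_prod, Finset.prod_apply, Finset.prod_const,
    Finset.card_univ]

lemma charFunDual_eq_charFun_apply_one (ν : Measure ℝ) (L : StrongDual ℝ ℝ) :
    charFunDual ν L = charFun ν (L 1) := by
  rw [charFun_eq_charFunDual_toDualMap]
  congr 1
  ext
  simp

lemma charFunDual_pi_eq_prod_charFun {ι : Type*} [Fintype ι] [DecidableEq ι] {ν : ι → Measure ℝ}
    [∀ i, SigmaFinite (ν i)] (L : StrongDual ℝ (ι → ℝ)) :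
    charFunDual (Measure.pi ν) L = ∏ i, charFun (ν i) (L (Pi.single i 1)) := by
  simp [charFunDual_pi, charFunDual_eq_charFun_apply_one]

section ComputationScaling

variable {α : Type*} {l : Filter α} {N R : α → ℝ} {p : ℝ}

lemma tendsto_atTop_of_tendsto_div (hN : Tendsto N l atTop) (hp : 0 < p)
    (hR : Tendsto (fun a => R a / N a) l (𝓝 p)) : Tendsto R l atTop := by
  refine (hR.pos_mul_atTop hp hN).congr' ?_
  filter_upwards [hN.eventually_ne_atTop 0] with a ha using div_mul_cancel₀ _ ha

lemma tendsto_sqrt_div_nhds_zero (hN : Tendsto N l atTop) (hp : p ≠ 0)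
    (hR : Tendsto (fun a => R a / N a) l (𝓝 p)) : Tendsto (fun a => √(N a) / R a) l (𝓝 0) := by
  have hsqrt : Tendsto (fun a => (√(N a))⁻¹) l (𝓝 0) :=
    tendsto_inv_atTop_zero.comp (Real.tendsto_sqrt_atTop.comp hN)
  refine (((hR.inv₀ hp).mul hsqrt).congr fun a => ?_).trans_eq (by simp)
  rw [inv_div, div_mul_eq_mul_div, ← div_eq_mul_inv, Real.div_sqrt]

lemma tendsto_mul_sq_sqrt_div (hN : Tendsto N l atTop) (hp : p ≠ 0)
    (hR : Tendsto (fun a => R a / N a) l (𝓝 p)) :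
    Tendsto (fun a => R a * (√(N a) / R a) ^ 2) l (𝓝 p⁻¹) := by
  refine (hR.inv₀ hp).congr' ?_
  filter_upwards [hN.eventually_ge_atTop 0] with a ha
  rw [inv_div, div_pow, Real.sq_sqrt ha]
  obtain hRa | hRa := eq_or_ne (R a) 0
  · simp [hRa]
  · field_simp

end ComputationScaling

section Application

variable {𝓧 : Type*} [MeasurableSpace 𝓧] {K : Kernel (ProbabilityMeasure 𝓧) ℝ}
  {ψ : ProbabilityMeasure 𝓧 → ℝ}

instance (n : ℕ+) (B : ℕ) : IsMarkovKernel (resamplesKernel 𝓧 n B) :=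
  inferInstanceAs (IsMarkovKernel (prodKernel fun _ => resampleKernel 𝓧 n))

instance [IsMarkovKernel K] (n : ℕ+) (B : ℕ) (R₀ R : ℕ+) :
    IsMarkovKernel (allRunsKernel K n B R₀ R) :=
  inferInstanceAs (IsMarkovKernel (_ ×ₖ prodKernel _))

variable (𝓧) in
/-- The class of all empirical distributions of finite nonempty samples, the distributions that
drive the computation runs. -/
def empiricalDistributions : Set (ProbabilityMeasure 𝓧) :=
  {Q | ∃ (n : ℕ+) (x : Fin n → 𝓧), empirical x = Q}

/-- The scaled error `√n (ψ(P*ₙ) - ψ(P̂ₙ))` of a resample `y` of the sample `x`. -/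
noncomputable def resampleError (ψ : ProbabilityMeasure 𝓧 → ℝ) {n : ℕ+} (x y : Fin n → 𝓧) : ℝ :=
  √(n : ℝ) * (ψ (empirical y) - ψ (empirical x))

/-- The scaled computation error `√n (R⁻¹ ∑ᵣ vᵣ - ψ(Q))` of runs `v` driven by the empirical
distribution `Q` of a sample `x` of size `n`. -/
noncomputable def runsError (ψ : ProbabilityMeasure 𝓧 → ℝ) {n R : ℕ+} (x : Fin n → 𝓧)
    (v : Fin R → ℝ) : ℝ :=
  √(n : ℝ) * (average v - ψ (empirical x))

lemma UnbiasedRuns.measurable_comp_empirical (hK : UnbiasedRuns K ψ (empiricalDistributions 𝓧))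
    (n : ℕ+) : Measurable fun x : Fin n → 𝓧 => ψ (empirical x) := by
  have hψ : (fun x : Fin n → 𝓧 => ψ (empirical x))
      = fun x => ∫ v, v ∂(K.comap empirical (measurable_empirical n) x) := by
    ext x
    exact (hK _ ⟨n, x, rfl⟩).2.symm
  rw [hψ]
  exact (StronglyMeasurable.integral_kernel measurable_id.stronglyMeasurable).measurable

lemma measurable_average {R : ℕ+} : Measurable (average : (Fin R → ℝ) → ℝ) := by
  unfold average
  fun_prop

lemma UnbiasedRuns.measurable_resampleError (hK : UnbiasedRuns K ψ (empiricalDistributions 𝓧))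
    {α : Type*} [MeasurableSpace α] {n : ℕ+} {x y : α → Fin n → 𝓧} (hx : Measurable x)
    (hy : Measurable y) : Measurable fun a => resampleError ψ (x a) (y a) :=
  (((hK.measurable_comp_empirical n).comp hy).sub
    ((hK.measurable_comp_empirical n).comp hx)).const_mul _

lemma UnbiasedRuns.measurable_runsError (hK : UnbiasedRuns K ψ (empiricalDistributions 𝓧))
    {α : Type*} [MeasurableSpace α] {n R : ℕ+} {x : α → Fin n → 𝓧} {v : α → Fin R → ℝ}
    (hx : Measurable x) (hv : Measurable v) : Measurable fun a => runsError ψ (x a) (v a) :=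
  ((measurable_average.comp hv).sub ((hK.measurable_comp_empirical n).comp hx)).const_mul _

lemma charFun_map_runsError [IsMarkovKernel K] {n R : ℕ+} (x : Fin n → 𝓧) (t : ℝ) :
    charFun ((runsKernel K n R x).map (runsError ψ x)) t
      = charFun ((K (empirical x)).map (· - ψ (empirical x))) (√(n : ℝ) / R * t) ^ (R : ℕ) := by
  have hR : (R : ℝ) ≠ 0 := by positivity
  have herror : runsError ψ x
      = fun v : Fin R → ℝ => √(n : ℝ) / R * ∑ r, (v r - ψ (empirical x)) := by
    ext v
    rw [runsError, average, Finset.sum_sub_distrib, Finset.sum_const, Finset.card_univ,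
      Fintype.card_fin, nsmul_eq_mul]
    field_simp
  have h := charFun_map_const_mul_sum_pi (ι := Fin R) (ν := K (empirical x))
    (measurable_id.sub_const (ψ (empirical x))) (√(n : ℝ) / R) t
  rw [Fintype.card_fin] at h
  rw [herror]
  exact h

section ConditionalLimits

variable {α : Type*} {l : Filter α} {N : α → ℕ+} {x : ∀ a, Fin (N a) → 𝓧} {B : ℕ}

lemma tendsto_charFun_map_runsError [IsMarkovKernel K] {R : α → ℕ+} {p τ : ℝ} {k : ℝ≥0∞}
    (hK : UnbiasedRuns K ψ (empiricalDistributions 𝓧)) (hN : Tendsto N l atTop) (hp : 0 < p)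
    (hR : Tendsto (fun a => (R a : ℝ) / N a) l (𝓝 p))
    (hvar : Tendsto (fun a => runVariance K (empirical (x a))) l (𝓝 (ENNReal.ofReal (τ ^ 2))))
    (hk : k ≠ ∞) (hthird : Tendsto (fun a => runThirdMoment K ψ (empirical (x a))) l (𝓝 k))
    (t : ℝ) :
    Tendsto (fun a => charFun ((runsKernel K (N a) (R a) (x a)).map (runsError ψ (x a))) t) l
      (𝓝 (charFun (gaussianReal 0 (τ ^ 2 / p).toNNReal) t)) := by
  have hNreal : Tendsto (fun a => ((N a : ℕ) : ℝ)) l atTop :=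
    tendsto_natCast_atTop_atTop.comp (tendsto_PNat_val_atTop_atTop.comp hN)
  have hRnat : Tendsto (fun a => (R a : ℕ)) l atTop :=
    tendsto_natCast_atTop_iff.1 (tendsto_atTop_of_tendsto_div hNreal hp hR)
  have hscale := tendsto_sqrt_div_nhds_zero hNreal hp.ne' hR
  have hscale_sq := tendsto_mul_sq_sqrt_div hNreal hp.ne' hR
  have hmean (a : α) : ∫ x, x ∂((K (empirical (x a))).map (· - ψ (empirical (x a)))) = 0 :=
    integral_map_sub_integral_eq_zero (hK _ ⟨_, x a, rfl⟩).1 (hK _ ⟨_, x a, rfl⟩).2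
  have hprob (a : α) : IsProbabilityMeasure
      ((K (empirical (x a))).map (· - ψ (empirical (x a)))) :=
    Measure.isProbabilityMeasure_map (by fun_prop)
  have hlim : charFun (gaussianReal 0 (τ ^ 2 / p).toNNReal) t
      = Complex.exp ((-(p⁻¹ * t ^ 2 * τ ^ 2 / 2) : ℝ) : ℂ) := by
    rw [charFun_gaussianReal, Real.coe_toNNReal _ (by positivity)]
    push_cast
    ring_nf
  simp_rw [charFun_map_runsError, hlim]
  refine tendsto_charFun_pow_of_lyapunov ?_ hmean hRnat ?_ ?_
  · filter_upwards [hthird.eventually_ne hk] with a ha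
    exact memLp_map_sub_const three_ne_zero ha
  · simp_rw [integral_sq_map_sub_integral (hK _ ⟨_, x _, rfl⟩).2]
    have hvar' := (ENNReal.tendsto_toReal ENNReal.ofReal_ne_top).comp hvar
    rw [ENNReal.toReal_ofReal (sq_nonneg τ)] at hvar'
    refine ((hscale_sq.mul_const (t ^ 2)).mul hvar').congr fun a => ?_
    rw [Function.comp_apply, runVariance]
    ring
  · simp_rw [integral_abs_pow_map_sub_const]
    have hthird' := (ENNReal.tendsto_toReal hk).comp hthird
    refine (((hscale_sq.mul (hscale.abs.mul_const (|t| ^ 3))).mul hthird').congr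
      fun a => ?_).trans_eq (by simp)
    rw [Function.comp_apply, runThirdMoment, abs_mul, ← sq_abs (_ / _)]
    ring

lemma tendsto_charFun_map_resampleError {γ : Measure ℝ} [IsProbabilityMeasure γ]
    (hψ : ∀ n : ℕ+, Measurable fun x : Fin n → 𝓧 => ψ (empirical x))
    (hcdf : ∀ t, Tendsto (fun a => bootstrapCDF ψ (N a) (x a) t) l (𝓝 (γ.real (Set.Iic t))))
    (t : ℝ) :
    Tendsto (fun a => charFun ((resampleKernel 𝓧 (N a) (x a)).map (resampleError ψ (x a))) t) l
      (𝓝 (charFun γ t)) := by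
  have hmeas (a : α) : Measurable (resampleError ψ (x a)) :=
    ((hψ (N a)).sub_const _).const_mul _
  let ν (a : α) : ProbabilityMeasure ℝ :=
    ⟨(resampleKernel 𝓧 (N a) (x a)).map (resampleError ψ (x a)),
      Measure.isProbabilityMeasure_map (hmeas a).aemeasurable⟩
  have hν : Tendsto ν l (𝓝 ⟨γ, inferInstance⟩) := by
    refine tendsto_probabilityMeasure_of_tendsto_cdf fun s => (hcdf s).congr fun a => ?_
    exact (map_measureReal_apply (hmeas a) measurableSet_Iic).symm
  simp_rw [charFun_eq_charFunDual_toDualMap]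
  exact tendsto_charFunDual_of_tendsto hν _

lemma tendsto_charFunDual_map_resamplesKernel {γ : Measure ℝ} [IsProbabilityMeasure γ]
    (hψ : ∀ n : ℕ+, Measurable fun x : Fin n → 𝓧 => ψ (empirical x))
    (hcdf : ∀ t, Tendsto (fun a => bootstrapCDF ψ (N a) (x a) t) l (𝓝 (γ.real (Set.Iic t))))
    (L : StrongDual ℝ (Fin B → ℝ)) :
    Tendsto (fun a => charFunDual ((resamplesKernel 𝓧 (N a) B (x a)).map
        fun y b => resampleError ψ (x a) (y b)) L) l
      (𝓝 (charFunDual (Measure.pi fun _ => γ) L)) := by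
  have hmeas (a : α) : Measurable (resampleError ψ (x a)) :=
    ((hψ (N a)).sub_const _).const_mul _
  have (a : α) : IsProbabilityMeasure
      ((resampleKernel 𝓧 (N a) (x a)).map (resampleError ψ (x a))) :=
    Measure.isProbabilityMeasure_map (hmeas a).aemeasurable
  have hmap (a : α) : (resamplesKernel 𝓧 (N a) B (x a)).map
      (fun y b => resampleError ψ (x a) (y b))
        = Measure.pi fun _ => (resampleKernel 𝓧 (N a) (x a)).map (resampleError ψ (x a)) :=
    Measure.pi_map_pi fun _ => (hmeas a).aemeasurable
  simp_rw [hmap, charFunDual_pi_eq_prod_charFun]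
  exact tendsto_finsetProd _ fun b _ => tendsto_charFun_map_resampleError hψ hcdf _

lemma tendsto_charFunDual_map_allRunsKernel [IsMarkovKernel K] {R₀ R : α → ℕ+}
    {y : ∀ a, Fin B → Fin (N a) → 𝓧} {γ₀ γ : Measure ℝ} [IsProbabilityMeasure γ₀]
    [IsProbabilityMeasure γ]
    (hdata : ∀ t, Tendsto
      (fun a => charFun ((runsKernel K (N a) (R₀ a) (x a)).map (runsError ψ (x a))) t) l
      (𝓝 (charFun γ₀ t)))
    (hresample : ∀ b t, Tendsto
      (fun a => charFun ((runsKernel K (N a) (R a) (y a b)).map (runsError ψ (y a b))) t) l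
      (𝓝 (charFun γ t)))
    (L : StrongDual ℝ (ℝ × (Fin B → ℝ))) :
    Tendsto (fun a => charFunDual ((allRunsKernel K (N a) B (R₀ a) (R a) (x a, y a)).map
        fun v => (runsError ψ (x a) v.1, fun b => runsError ψ (y a b) (v.2 b))) L) l
      (𝓝 (charFunDual (γ₀.prod (Measure.pi fun _ => γ)) L)) := by
  have hmeas {n R : ℕ+} (x : Fin n → 𝓧) : Measurable (runsError (R := R) ψ x) :=
    (measurable_average.sub_const _).const_mul _
  have {n : ℕ+} (R : ℕ+) (x : Fin n → 𝓧) :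
      IsProbabilityMeasure ((runsKernel K n R x).map (runsError ψ x)) :=
    Measure.isProbabilityMeasure_map (hmeas x).aemeasurable
  have hmap (a : α) : (allRunsKernel K (N a) B (R₀ a) (R a) (x a, y a)).map
      (fun v => (runsError ψ (x a) v.1, fun b => runsError ψ (y a b) (v.2 b)))
        = ((runsKernel K (N a) (R₀ a) (x a)).map (runsError ψ (x a))).prod
          (Measure.pi fun b => (runsKernel K (N a) (R a) (y a b)).map (runsError ψ (y a b))) := by
    have hmeas_pi : Measurable fun (w : Fin B → Fin (R a) → ℝ) b => runsError ψ (y a b) (w b) :=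
      measurable_pi_lambda _ fun b => (hmeas (y a b)).comp (measurable_pi_apply b)
    rw [← Measure.pi_map_pi fun b => (hmeas (y a b)).aemeasurable,
      Measure.map_prod_map _ _ (hmeas (x a)) hmeas_pi, allRunsKernel, Kernel.prod_apply]
    rfl
  simp_rw [hmap, charFunDual_prod, charFunDual_pi_eq_prod_charFun,
    charFunDual_eq_charFun_apply_one]
  exact (hdata _).mul (tendsto_finsetProd _ fun b _ => hresample b _)

end ConditionalLimits

end Application

section LimitLaw

variable {Ω : Type*} [MeasurableSpace Ω] {μ : Measure Ω} {B : ℕ}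

lemma tendstoInDistribution_of_hasLaw [IsProbabilityMeasure μ] {E ι : Type*} {Ω' : ι → Type*}
    [∀ i, MeasurableSpace (Ω' i)] [TopologicalSpace E] [MeasurableSpace E] [OpensMeasurableSpace E]
    {X : ∀ i, Ω' i → E} {l : Filter ι} {P : ∀ i, Measure (Ω' i)} [∀ i, IsProbabilityMeasure (P i)]
    {ρ : Measure E} [IsProbabilityMeasure ρ] {T : Ω → E} (h : TendstoInDistribution X l id P ρ)
    (hT : HasLaw T ρ μ) : TendstoInDistribution X l T P μ where
  forall_aemeasurable := h.forall_aemeasurable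
  aemeasurable_limit := hT.aemeasurable
  tendsto := by simpa only [hT.map_eq, Measure.map_id] using h.tendsto

lemma hasLaw_const_mul_gaussianReal {Z : Ω → ℝ} (hZ : HasLaw Z (gaussianReal 0 1) μ) (c : ℝ) :
    HasLaw (fun ω => c * Z ω) (gaussianReal 0 (c ^ 2).toNNReal) μ := by
  have hvar : NNReal.mk (c ^ 2) (sq_nonneg c) * 1 = (c ^ 2).toNNReal := by
    rw [mul_one, Real.toNNReal_of_nonneg (sq_nonneg c)]
  simpa only [mul_zero, hvar] using gaussianReal_const_mul hZ c

lemma hasLaw_prodMk_of_iIndepFun_sumElim {𝓨 : Type*} [MeasurableSpace 𝓨]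
    {S T : Fin (B + 1) → Ω → 𝓨} {ν ρ : Fin (B + 1) → Measure 𝓨} [∀ b, IsProbabilityMeasure (ν b)]
    [∀ b, IsProbabilityMeasure (ρ b)] (hS : ∀ b, HasLaw (S b) (ν b) μ)
    (hT : ∀ b, HasLaw (T b) (ρ b) μ) (hST : iIndepFun (Sum.elim S T) μ) :
    HasLaw (fun ω => ((S 0 ω, fun b : Fin B => S b.succ ω), (T 0 ω, fun b : Fin B => T b.succ ω)))
      (((ν 0).prod (Measure.pi fun b => ν b.succ)).prod
        ((ρ 0).prod (Measure.pi fun b => ρ b.succ))) μ := by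
  have hprob : ∀ i, IsProbabilityMeasure (Sum.elim ν ρ i) := by
    rintro (b | b) <;> dsimp only [Sum.elim_inl, Sum.elim_inr] <;> infer_instance
  have hjoint : HasLaw (fun ω i => Sum.elim S T i ω) (Measure.pi (Sum.elim ν ρ)) μ :=
    hST.hasLaw_pi (Sum.rec hS hT)
  exact (((measurePreserving_piFinSuccAbove ν 0).prod (measurePreserving_piFinSuccAbove ρ 0)).comp
    (measurePreserving_sumPiEquivProdPi (Sum.elim ν ρ))).comp_hasLaw hjoint

lemma hasLaw_prodMk_gaussianReal {Z W : Fin (B + 1) → Ω → ℝ}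
    (hZ : ∀ b, HasLaw (Z b) (gaussianReal 0 1) μ) (hW : ∀ b, HasLaw (W b) (gaussianReal 0 1) μ)
    (hZW : iIndepFun (Sum.elim Z W) μ) (a : ℝ) (c : Fin (B + 1) → ℝ) :
    HasLaw (fun ω => ((a * Z 0 ω, fun b : Fin B => a * Z b.succ ω),
        (c 0 * W 0 ω, fun b : Fin B => c b.succ * W b.succ ω)))
      (((gaussianReal 0 (a ^ 2).toNNReal).prod
          (Measure.pi fun _ => gaussianReal 0 (a ^ 2).toNNReal)).prod
        ((gaussianReal 0 (c 0 ^ 2).toNNReal).prod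
          (Measure.pi fun b => gaussianReal 0 (c b.succ ^ 2).toNNReal))) μ := by
  refine hasLaw_prodMk_of_iIndepFun_sumElim (S := fun b ω => a * Z b ω)
    (T := fun b ω => c b * W b ω) (fun b => hasLaw_const_mul_gaussianReal (hZ b) a)
    (fun b => hasLaw_const_mul_gaussianReal (hW b) (c b)) ?_
  convert hZW.comp (Sum.elim (fun _ z => a * z) fun b w => c b * w) ?_ using 1
  · ext (b | b) ω <;> rfl
  · rintro (_ | _) <;> exact measurable_const_mul _

end LimitLaw

section JointLimit

variable {Ω 𝓧 : Type*} [MeasurableSpace Ω] [MeasurableSpace 𝓧] {μ : Measure Ω}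
  {P : ProbabilityMeasure 𝓧} {ψ : ProbabilityMeasure 𝓧 → ℝ}
  {K : Kernel (ProbabilityMeasure 𝓧) ℝ} {B : ℕ} {R₀ R : ℕ+ → ℕ+}
  {X : ℕ → Ω → 𝓧} {Y : (n : ℕ+) → Ω → Fin B → Fin n → 𝓧}
  {V₀ : (n : ℕ+) → Ω → Fin (R₀ n) → ℝ} {V : (n : ℕ+) → Ω → Fin B → Fin (R n) → ℝ}
  {σ τ p₀ p : ℝ}

lemma tendsto_charFun_map_runsError_inProbability [IsMarkovKernel K] {R : ℕ+ → ℕ+}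
    {x : (n : ℕ+) → Ω → Fin n → 𝓧} (hK : UnbiasedRuns K ψ (empiricalDistributions 𝓧))
    (hp : 0 < p) (hR : Tendsto (fun n : ℕ+ => (R n : ℝ) / (n : ℝ)) atTop (𝓝 p))
    (hτ : runVariance K P = ENNReal.ofReal (τ ^ 2)) (hthird_lt : runThirdMoment K ψ P < ∞)
    (hvar : TendstoInMeasure μ (fun (n : ℕ+) ω => runVariance K (empirical (x n ω))) atTop
      fun _ => runVariance K P)
    (hthird : TendstoInMeasure μ (fun (n : ℕ+) ω => runThirdMoment K ψ (empirical (x n ω))) atTop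
      fun _ => runThirdMoment K ψ P) (t : ℝ) :
    Tendsto (fun q : ℕ+ × Ω =>
        charFun ((runsKernel K q.1 (R q.1) (x q.1 q.2)).map (runsError ψ (x q.1 q.2))) t)
      (inProbability μ atTop) (𝓝 (charFun (gaussianReal 0 (τ ^ 2 / p).toNNReal) t)) := by
  have hN : Tendsto Prod.fst (inProbability μ (atTop : Filter ℕ+)) atTop :=
    tendsto_fst_inProbability
  have hvar' := tendsto_inProbability_of_tendstoInMeasure hvar
  have hthird' := tendsto_inProbability_of_tendstoInMeasure hthird
  rw [hτ] at hvar'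
  exact tendsto_charFun_map_runsError (N := Prod.fst) (R := fun q => R q.1)
    (x := fun q => x q.1 q.2) hK hN hp (hR.comp hN) hvar' hthird_lt.ne hthird' t

variable [IsProbabilityMeasure μ]

lemma tendstoInDistribution_samplingErrors (hK : UnbiasedRuns K ψ (empiricalDistributions 𝓧))
    (hY : ∀ n, HasCondDistrib (Y n) (sample X n) (resamplesKernel 𝓧 n B) μ)
    (hboot : BootstrapValid μ P ψ X σ) :
    TendstoInDistribution
      (fun (n : ℕ+) ω => (√(n : ℝ) * (ψ (empirical (sample X n ω)) - ψ P),
        fun b => resampleError ψ (sample X n ω) (Y n ω b)))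
      atTop id (fun _ => μ)
      ((gaussianReal 0 (σ ^ 2).toNNReal).prod
        (Measure.pi fun _ => gaussianReal 0 (σ ^ 2).toNNReal)) := by
  refine tendstoInDistribution_prodMk_of_hasCondDistrib hY
    (f := fun (n : ℕ+) x => √(n : ℝ) * (ψ (empirical x) - ψ P))
    (g := fun n (z : (Fin n → 𝓧) × (Fin B → Fin n → 𝓧)) b => resampleError ψ z.1 (z.2 b))
    (fun n => ((hK.measurable_comp_empirical n).sub_const _).const_mul _)
    (fun n => measurable_pi_lambda _ fun b =>
      hK.measurable_resampleError measurable_fst (by fun_prop))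
    hboot.original fun L => ?_
  exact tendsto_charFunDual_map_resamplesKernel hK.measurable_comp_empirical
    (fun t => tendsto_inProbability_of_tendstoInMeasure (hboot.resample t)) L

lemma tendstoInDistribution_samplingErrors_runsErrors [IsMarkovKernel K]
    (hK : UnbiasedRuns K ψ (empiricalDistributions 𝓧))
    (hY : ∀ n, HasCondDistrib (Y n) (sample X n) (resamplesKernel 𝓧 n B) μ)
    (hV : ∀ n, HasCondDistrib (fun ω => (V₀ n ω, V n ω)) (fun ω => (sample X n ω, Y n ω))
      (allRunsKernel K n B (R₀ n) (R n)) μ)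
    (hboot : BootstrapValid μ P ψ X σ) (hmoment : MomentConsistent μ P K ψ X Y τ)
    (hp₀ : 0 < p₀) (hp : 0 < p)
    (hR₀ : Tendsto (fun n : ℕ+ => (R₀ n : ℝ) / (n : ℝ)) atTop (𝓝 p₀))
    (hR : Tendsto (fun n : ℕ+ => (R n : ℝ) / (n : ℝ)) atTop (𝓝 p)) :
    TendstoInDistribution
      (fun (n : ℕ+) ω => ((√(n : ℝ) * (ψ (empirical (sample X n ω)) - ψ P),
          fun b => resampleError ψ (sample X n ω) (Y n ω b)),
        (runsError ψ (sample X n ω) (V₀ n ω), fun b => runsError ψ (Y n ω b) (V n ω b))))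
      atTop id (fun _ => μ)
      (((gaussianReal 0 (σ ^ 2).toNNReal).prod
          (Measure.pi fun _ => gaussianReal 0 (σ ^ 2).toNNReal)).prod
        ((gaussianReal 0 (τ ^ 2 / p₀).toNNReal).prod
          (Measure.pi fun _ => gaussianReal 0 (τ ^ 2 / p).toNNReal))) := by
  refine tendstoInDistribution_prodMk_of_hasCondDistrib
    (X := fun n ω => (sample X n ω, Y n ω)) (Y := fun n ω => (V₀ n ω, V n ω))
    (κ := fun n => allRunsKernel K n B (R₀ n) (R n))
    (f := fun (n : ℕ+) (z : (Fin n → 𝓧) × (Fin B → Fin n → 𝓧)) =>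
      (√(n : ℝ) * (ψ (empirical z.1) - ψ P), fun b => resampleError ψ z.1 (z.2 b)))
    (g := fun n (z : ((Fin n → 𝓧) × (Fin B → Fin n → 𝓧)) ×
        ((Fin (R₀ n) → ℝ) × (Fin B → Fin (R n) → ℝ))) =>
      (runsError ψ z.1.1 z.2.1, fun b => runsError ψ (z.1.2 b) (z.2.2 b)))
    hV (fun n => ?_) (fun n => ?_) (tendstoInDistribution_samplingErrors hK hY hboot) fun L => ?_
  · have hψ : Measurable fun z : (Fin n → 𝓧) × (Fin B → Fin n → 𝓧) => ψ (empirical z.1) :=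
      (hK.measurable_comp_empirical n).comp measurable_fst
    exact ((hψ.sub_const _).const_mul _).prodMk <| measurable_pi_lambda _ fun b =>
      hK.measurable_resampleError measurable_fst (by fun_prop)
  · exact (hK.measurable_runsError (by fun_prop) (by fun_prop)).prodMk <|
      measurable_pi_lambda _ fun b => hK.measurable_runsError (by fun_prop) (by fun_prop)
  · exact tendsto_charFunDual_map_allRunsKernel
      (tendsto_charFun_map_runsError_inProbability hK hp₀ hR₀ hmoment.variance_eq
        hmoment.thirdMoment_lt_top hmoment.variance_data hmoment.thirdMoment_data)
      (fun b => tendsto_charFun_map_runsError_inProbability hK hp hR hmoment.variance_eq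
        hmoment.thirdMoment_lt_top (hmoment.variance_resample b)
        (hmoment.thirdMoment_resample b)) L

end JointLimit

section Recombination

/-- The scaled errors of the computed estimates `ψ̂̂ₙ, ψₙ**¹, …, ψₙ**ᴮ`, the first one centered at
`ψ(P)` and the others at `ψ̂̂ₙ`, in terms of the sampling errors `e.1` and the computation errors
`e.2` (original estimate first, resamples second). -/
def combineErrors {B : ℕ} (e : (ℝ × (Fin B → ℝ)) × (ℝ × (Fin B → ℝ))) : Fin (B + 1) → ℝ :=
  Fin.cons (e.1.1 + e.2.1) fun b => e.1.2 b + e.2.2 b - e.2.1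

lemma continuous_combineErrors {B : ℕ} : Continuous (combineErrors (B := B)) := by
  unfold combineErrors
  fun_prop

lemma combineErrors_resampleError_runsError {𝓧 : Type*} [MeasurableSpace 𝓧]
    (ψ : ProbabilityMeasure 𝓧 → ℝ) {B : ℕ} {n R₀ R : ℕ+} (c : ℝ) (x : Fin n → 𝓧)
    (y : Fin B → Fin n → 𝓧) (v₀ : Fin R₀ → ℝ) (v : Fin B → Fin R → ℝ) :
    combineErrors ((√(n : ℝ) * (ψ (empirical x) - c), fun b => resampleError ψ x (y b)),
        (runsError ψ x v₀, fun b => runsError ψ (y b) (v b)))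
      = Fin.cons (√(n : ℝ) * (average v₀ - c))
          fun b => √(n : ℝ) * (average (v b) - average v₀) := by
  ext i
  refine Fin.cases ?_ (fun b => ?_) i
  · simp only [combineErrors, runsError, Fin.cons_zero]
    ring
  · simp only [combineErrors, resampleError, runsError, Fin.cons_succ]
    ring

end Recombination

end CheapBootstrap

theorem theorem3_general {Ω Ω' 𝓧 : Type*} [MeasurableSpace Ω] [MeasurableSpace Ω']
    [MeasurableSpace 𝓧] (μ : Measure Ω) [IsProbabilityMeasure μ] (μ' : Measure Ω')
    [IsProbabilityMeasure μ'] (P : ProbabilityMeasure 𝓧) (ψ : ProbabilityMeasure 𝓧 → ℝ)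
    (K : Kernel (ProbabilityMeasure 𝓧) ℝ) [IsMarkovKernel K]
    (hK : UnbiasedRuns K ψ (empiricalDistributions 𝓧)) (B : ℕ) (R₀ R : ℕ+ → ℕ+)
    (X : ℕ → Ω → 𝓧) (Y : (n : ℕ+) → Ω → Fin B → Fin n → 𝓧)
    (V₀ : (n : ℕ+) → Ω → Fin (R₀ n) → ℝ) (V : (n : ℕ+) → Ω → Fin B → Fin (R n) → ℝ)
    (hY : ∀ n, HasCondDistrib (Y n) (sample X n) (resamplesKernel 𝓧 n B) μ)
    (hV : ∀ n, HasCondDistrib (fun ω => (V₀ n ω, V n ω)) (fun ω => (sample X n ω, Y n ω))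
      (allRunsKernel K n B (R₀ n) (R n)) μ)
    (σ τ : ℝ) (hboot : BootstrapValid μ P ψ X σ) (hmoment : MomentConsistent μ P K ψ X Y τ)
    (p₀ p : ℝ) (hp₀ : 0 < p₀) (hp : 0 < p)
    (hR₀ : Tendsto (fun n : ℕ+ => (R₀ n : ℝ) / (n : ℝ)) atTop (𝓝 p₀))
    (hR : Tendsto (fun n : ℕ+ => (R n : ℝ) / (n : ℝ)) atTop (𝓝 p))
    (Z W : Fin (B + 1) → Ω' → ℝ) (hZ : ∀ b, HasLaw (Z b) (gaussianReal 0 1) μ')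
    (hW : ∀ b, HasLaw (W b) (gaussianReal 0 1) μ') (hZW : iIndepFun (Sum.elim Z W) μ') :
    TendstoInDistribution
      (fun (n : ℕ+) ω => (Fin.cons
        (√(n : ℝ) * (average (V₀ n ω) - ψ P))
        (fun b : Fin B => √(n : ℝ) * (average (V n ω b) - average (V₀ n ω))) :
          Fin (B + 1) → ℝ))
      atTop
      (fun ω' => (Fin.cons
        (σ * Z 0 ω' + τ / √p₀ * W 0 ω')
        (fun b : Fin B => σ * Z b.succ ω' + τ / √p * W b.succ ω' - τ / √p₀ * W 0 ω') :
          Fin (B + 1) → ℝ))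
      (fun _ => μ) μ' := by
  have herrors := tendstoInDistribution_samplingErrors_runsErrors hK hY hV hboot hmoment
    hp₀ hp hR₀ hR
  have hlaw := hasLaw_prodMk_gaussianReal hZ hW hZW σ
    (Fin.cons (τ / √p₀) fun _ => τ / √p)
  simp only [Fin.cons_zero, Fin.cons_succ, div_pow, Real.sq_sqrt hp₀.le, Real.sq_sqrt hp.le]
    at hlaw
  have hcombined := (tendstoInDistribution_of_hasLaw herrors hlaw).continuous_comp
    continuous_combineErrors
  simp only [Function.comp_def, combineErrors_resampleError_runsError] at hcombined
  exact hcombined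

theorem theorem3 {Ω Ω' 𝓧 : Type*} [MeasurableSpace Ω] [MeasurableSpace Ω'] [MeasurableSpace 𝓧]
    (μ : Measure Ω) [IsProbabilityMeasure μ] (μ' : Measure Ω') [IsProbabilityMeasure μ']
    -- the data distribution, a class of distributions, the functional, the law of a run
    (P : ProbabilityMeasure 𝓧) (𝓓 : Set (ProbabilityMeasure 𝓧)) (hP : P ∈ 𝓓)
    (hemp : ∀ (n : ℕ+) (x : Fin n → 𝓧), empirical x ∈ 𝓓)
    (ψ : ProbabilityMeasure 𝓧 → ℝ)
    (K : Kernel (ProbabilityMeasure 𝓧) ℝ) [IsMarkovKernel K] (hK : UnbiasedRuns K ψ 𝓓)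
    -- data, resamples and computation runs
    (B : ℕ) (R₀ R : ℕ+ → ℕ+)
    (X : ℕ → Ω → 𝓧) (Y : (n : ℕ+) → Ω → Fin B → Fin n → 𝓧)
    (V₀ : (n : ℕ+) → Ω → Fin (R₀ n) → ℝ) (V : (n : ℕ+) → Ω → Fin B → Fin (R n) → ℝ)
    (hsampling : NestedSampling μ P K B R₀ R X Y V₀ V)
    -- the two assumptions
    (σ τ : ℝ) (hboot : BootstrapValid μ P ψ X σ) (hmoment : MomentConsistent μ P K ψ X Y τ)
    -- computation sizes
    (p₀ p : ℝ) (hp₀ : 0 < p₀) (hp₀' : p₀ < 1) (hp : 0 < p) (hp' : p < 1)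
    (hR₀ : Tendsto (fun n : ℕ+ => (R₀ n : ℝ) / (n : ℝ)) atTop (𝓝 p₀))
    (hR : Tendsto (fun n : ℕ+ => (R n : ℝ) / (n : ℝ)) atTop (𝓝 p))
    -- independent standard normal variables
    (Z W : Fin (B + 1) → Ω' → ℝ) (hZ : ∀ b, HasLaw (Z b) (gaussianReal 0 1) μ')
    (hW : ∀ b, HasLaw (W b) (gaussianReal 0 1) μ') (hZW : iIndepFun (Sum.elim Z W) μ') :
    TendstoInDistribution
      (fun (n : ℕ+) ω => (Fin.cons
        (√(n : ℝ) * (average (V₀ n ω) - ψ P))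
        (fun b : Fin B => √(n : ℝ) * (average (V n ω b) - average (V₀ n ω))) :
          Fin (B + 1) → ℝ))
      atTop
      (fun ω' => (Fin.cons
        (σ * Z 0 ω' + τ / √p₀ * W 0 ω')
        (fun b : Fin B => σ * Z b.succ ω' + τ / √p * W b.succ ω' - τ / √p₀ * W 0 ω') :
          Fin (B + 1) → ℝ))
      (fun _ => μ) μ' := by
  exact theorem3_general μ μ' P ψ K (fun Q ⟨n, x, hx⟩ => hK Q (hx ▸ hemp n x)) B R₀ R X Y V₀ V
    hsampling.resamples hsampling.runs σ τ hboot hmoment p₀ p hp₀ hp hR₀ hR Z W hZ hW hZW
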